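/- Graphs are finite and may have loops and parallel edges; $V(G)$, $E(G)$ denote the vertex and edge sets of $G$, and $\Delta G = |E(G)| - |V(G)|$. For $X \subseteq E(G)$, $G\langle X\rangle$ is the subgraph whose edges are those in $X$ and whose vertices are the ends of the edges in $X$. For $k \ge 1$ let $\mathcal C_k(G)$ be the family of all $C \subseteq E(G)$ such that $\Delta G\langle C\rangle = k$ and $G\langle C\rangle$ has no isolated vertex, no vertex of degree $1$ (a loop counts twice in degrees) and no component that is a cycle. The family $\mathcal C_k(G)$ is the set of circuits of a matroid on $E(G)$, the $k$-circular matroid $M_k(G)$ of $G$; let $\rho^*_k(G)$ be its corank (the rank of its dual). For a vertex $v$ let $S(v,G)$ be the set of edges incident to $v$, $s(v,G) = |S(v,G)|$, and $\mathcal S(G) = \{S(v,G) : v \in V(G)\}$. A graph is $3$-connected if it has no loops (parallel edges are allowed) and at least four vertices, and remains connected after the deletion of any at most two vertices. Two graphs $G$, $G'$ with $E(G) = E(G')$ are strongly isomorphic if there is a bijection $\nu : V(G) \to V(G')$ such that an edge $e$ has ends $x, y$ in $G$ if and only if it has ends $\nu(x), \nu(y)$ in $G'$. **Theorem.** Let $G$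 and $G'$ be finite graphs, where $G'$ has no isolated vertices, let $t \in V(G)$, and let $k \ge 1$. Suppose that (a1) $G$ is $3$-connected, (a2) $\mathcal C_k(G) \neq \emptyset$, (a3) $s(t,G) = \rho^*_k(G) + 1$ (that is, $t$ is $k$-tight), and $s(x,G) \le \rho^*_k(G)$ for every vertex $x \ne t$ of $G$ (that is, $x$ is $k$-small), and (a4) $M_k(G') = M_k(G)$. Then $\mathcal S(G) = \mathcal S(G')$ and $G$ and $G'$ are strongly isomorphic. -/

import Mathlib

namespace Graph

variable {α β α' : Type*}

/-! ### Finite multigraphs -/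

/-- The degree of a vertex; a loop counts twice. -/
noncomputable def degree (G : Graph α β) (v : α) : ℕ :=
  (G.incidenceSet v).ncard + (G.loopSet v).ncard

/-- `G` is nonempty and any two of its vertices are joined by a walk. -/
def Connected (G : Graph α β) : Prop :=
  V(G).Nonempty ∧ ∀ x ∈ V(G), ∀ y ∈ V(G), Relation.ReflTransGen G.Adj x y

/-- A (finite) graph is a cycle if it is connected and all its degrees are two.
Loops (one vertex) and pairs of parallel edges (two vertices) are cycles. -/
def IsCycle (G : Graph α β) : Prop :=
  G.Connected ∧ ∀ v ∈ V(G), G.degree v = 2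

/-- `H` is a component of `G` that is a cycle. (`H ≤c G` says that `H` is a union of
components of `G`, so that a connected such `H` is one component.) -/
def IsCycleComponent (H G : Graph α β) : Prop :=
  H ≤c G ∧ H.IsCycle

/-- A cacti-graph: no isolated vertices, no leaves, no cycle components. -/
def IsCactiGraph (G : Graph α β) : Prop :=
  (∀ v ∈ V(G), G.degree v ≠ 0) ∧ (∀ v ∈ V(G), G.degree v ≠ 1) ∧
    ¬ ∃ H : Graph α β, H.IsCycleComponent G

/-- `Δ G = |E(G)| - |V(G)|`. -/
noncomputable def excess (G : Graph α β) : ℤ :=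
  (E(G).ncard : ℤ) - (V(G).ncard : ℤ)

/-- The subgraph `G⟨X⟩` induced by a set `X` of edges: its edges are those in `X`, and its vertices
are the ends of the edges in `X`. -/
def edgeInduce (G : Graph α β) (X : Set β) : Graph α β where
  vertexSet := {v | ∃ e ∈ X, G.Inc e v}
  edgeSet := E(G) ∩ X
  IsLink e x y := e ∈ X ∧ G.IsLink e x y
  isLink_symm _ _ := { symm _ _ h := ⟨h.1, h.2.symm⟩ }
  eq_or_eq_of_isLink_of_isLink _ _ _ _ _ h h' := h.2.left_eq_or_eq h'.2
  edge_mem_iff_exists_isLink e := by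
    constructor
    · rintro ⟨he, heX⟩
      obtain ⟨x, y, h⟩ := G.exists_isLink_of_mem_edgeSet he
      exact ⟨x, y, heX, h⟩
    · rintro ⟨x, y, heX, h⟩
      exact ⟨h.edge_mem, heX⟩
  left_mem_of_isLink e _ _ h := ⟨e, h.1, h.2.inc_left⟩

/-- The family `𝓒ₖ(G)` of edge sets `C` such that `G⟨C⟩` is a cacti-graph with `Δ G⟨C⟩ = k`. -/
def kCircuits (G : Graph α β) (k : ℕ) : Set (Set β) :=
  {C | C ⊆ E(G) ∧ (G.edgeInduce C).excess = k ∧ (G.edgeInduce C).IsCactiGraph}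

/-! ### Facts showing that `𝓒ₖ(G)` is the family of circuits of a matroid -/

section Aux

variable {G : Graph α β} {X Y A B : Set β}

theorem vertexSet_edgeInduce_finite (G : Graph α β) (hX : X.Finite) :
    V(G.edgeInduce X).Finite := by
  have h : V(G.edgeInduce X) = ⋃ e ∈ X, {v | G.Inc e v} := by
    ext v; simp [edgeInduce]
  rw [h]
  refine hX.biUnion fun e _ ↦ ?_
  by_cases he : e ∈ E(G)
  · obtain ⟨x, y, hxy⟩ := G.exists_isLink_of_mem_edgeSet he
    refine (Set.toFinite {x, y}).subset fun v hv ↦ ?_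
    exact hv.eq_or_eq_of_isLink hxy
  · simp [not_inc_of_notMem_edgeSet he]

theorem vertexSet_edgeInduce_mono (h : X ⊆ Y) : V(G.edgeInduce X) ⊆ V(G.edgeInduce Y) :=
  fun _ ⟨e, he, hv⟩ ↦ ⟨e, h he, hv⟩

theorem vertexSet_edgeInduce_union :
    V(G.edgeInduce (A ∪ B)) = V(G.edgeInduce A) ∪ V(G.edgeInduce B) := by
  ext v
  simp only [edgeInduce, Set.mem_union, Set.mem_ofPred_eq]
  grind

theorem excess_edgeInduce (h : X ⊆ E(G)) :
    (G.edgeInduce X).excess = (X.ncard : ℤ) - (V(G.edgeInduce X).ncard : ℤ) := by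
  have : E(G.edgeInduce X) = X := Set.inter_eq_right.2 h
  rw [excess, this]

theorem edgeInduce_inc {e : β} {v : α} :
    (G.edgeInduce X).Inc e v ↔ e ∈ X ∧ G.Inc e v := by
  simp [Inc, edgeInduce]

theorem excess_edgeInduce_supermodular (hE : E(G).Finite) (hA : A ⊆ E(G)) (hB : B ⊆ E(G)) :
    (G.edgeInduce A).excess + (G.edgeInduce B).excess ≤
      (G.edgeInduce (A ∪ B)).excess + (G.edgeInduce (A ∩ B)).excess := by
  rw [excess_edgeInduce hA, excess_edgeInduce hB, excess_edgeInduce (Set.union_subset hA hB),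
    excess_edgeInduce (Set.inter_subset_left.trans hA), vertexSet_edgeInduce_union]
  have hAf := hE.subset hA
  have hBf := hE.subset hB
  have h1 := Set.ncard_union_add_ncard_inter A B hAf hBf
  have h2 := Set.ncard_union_add_ncard_inter _ _ (G.vertexSet_edgeInduce_finite hAf)
    (G.vertexSet_edgeInduce_finite hBf)
  have h3 : V(G.edgeInduce (A ∩ B)).ncard ≤
      (V(G.edgeInduce A) ∩ V(G.edgeInduce B)).ncard :=
    Set.ncard_le_ncard (Set.subset_inter (vertexSet_edgeInduce_mono Set.inter_subset_left)
      (vertexSet_edgeInduce_mono Set.inter_subset_right))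
      ((G.vertexSet_edgeInduce_finite hAf).inter_of_left _)
  omega

open Classical in
/-- The number of ends of `e` in `W`, a loop having two ends. -/
noncomputable def endCount (G : Graph α β) (W : Finset α) (e : β) : ℕ :=
  (W.filter (G.Inc e)).card + (W.filter (G.IsLoopAt e)).card

theorem sum_degree_eq (hE : E(G).Finite) (W : Finset α) :
    ∑ v ∈ W, G.degree v = ∑ e ∈ hE.toFinset, G.endCount W e := by
  classical
  have h1 : ∀ v, (G.incidenceSet v).ncard = (hE.toFinset.filter (G.Inc · v)).card := by
    intro v
    rw [← Set.ncard_coe_finset]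
    congr 1
    ext e
    simp only [mem_incidenceSet, Finset.coe_filter, Set.Finite.mem_toFinset, Set.mem_ofPred_eq]
    exact ⟨fun h ↦ ⟨h.edge_mem, h⟩, fun h ↦ h.2⟩
  have h2 : ∀ v, (G.loopSet v).ncard = (hE.toFinset.filter (G.IsLoopAt · v)).card := by
    intro v
    rw [← Set.ncard_coe_finset]
    congr 1
    ext e
    simp only [mem_loopSet, Finset.coe_filter, Set.Finite.mem_toFinset, Set.mem_ofPred_eq]
    exact ⟨fun h ↦ ⟨h.edge_mem, h⟩, fun h ↦ h.2⟩
  simp only [degree, endCount, Finset.sum_add_distrib, h1, h2]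
  congr 1
  · exact (Finset.sum_card_bipartiteAbove_eq_sum_card_bipartiteBelow (s := hE.toFinset) (t := W)
      (fun e v ↦ G.Inc e v)).symm
  · exact (Finset.sum_card_bipartiteAbove_eq_sum_card_bipartiteBelow (s := hE.toFinset) (t := W)
      (fun e v ↦ G.IsLoopAt e v)).symm

theorem endCount_eq {e : β} {x y : α} (h : G.IsLink e x y) (W : Finset α) [DecidableEq α] :
    G.endCount W e = (if x ∈ W then 1 else 0) + (if y ∈ W then 1 else 0) := by
  classical
  have hinc : ∀ v, G.Inc e v ↔ v = x ∨ v = y := fun v ↦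
    ⟨fun hv ↦ hv.eq_or_eq_of_isLink h, by rintro (rfl | rfl); exacts [h.inc_left, h.inc_right]⟩
  have hloop : ∀ v, G.IsLoopAt e v ↔ v = x ∧ v = y := by
    intro v
    rw [← isLink_self_iff, h.isLink_iff]
    grind
  have e1 : W.filter (G.Inc e) = W.filter (fun v ↦ v = x ∨ v = y) :=
    Finset.filter_congr fun v _ ↦ hinc v
  have e2 : W.filter (G.IsLoopAt e) = W.filter (fun v ↦ v = x ∧ v = y) :=
    Finset.filter_congr fun v _ ↦ hloop v
  have e3 := Finset.card_union_add_card_inter (W.filter (· = x)) (W.filter (· = y))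
  rw [endCount, e1, e2, Finset.filter_or, Finset.filter_and, e3, Finset.filter_eq',
    Finset.filter_eq']
  split_ifs <;> simp

/-- In a cycle there are as many edges as vertices. -/
theorem IsCycle.ncard_eq (h : G.IsCycle) (hE : E(G).Finite) (hV : V(G).Finite) :
    E(G).ncard = V(G).ncard := by
  classical
  have h1 := sum_degree_eq hE hV.toFinset
  have h2 : ∑ v ∈ hV.toFinset, G.degree v = ∑ v ∈ hV.toFinset, 2 :=
    Finset.sum_congr rfl fun v hv ↦ h.2 v (by simpa using hv)
  have h3 : ∑ e ∈ hE.toFinset, G.endCount hV.toFinset e = ∑ e ∈ hE.toFinset, 2 := by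
    refine Finset.sum_congr rfl fun e he ↦ ?_
    obtain ⟨x, y, hxy⟩ := G.exists_isLink_of_mem_edgeSet (by simpa using he)
    rw [endCount_eq hxy]
    simp [hxy.left_mem, hxy.right_mem]
  rw [h2, h3] at h1
  simp only [Finset.sum_const, smul_eq_mul] at h1
  rw [Set.ncard_eq_toFinset_card _ hE, Set.ncard_eq_toFinset_card _ hV]
  omega

theorem exists_ssubset_of_notMem_kCircuits (hE : E(G).Finite) {k : ℕ} (hk : 1 ≤ k)
    (hX : X ⊆ E(G)) (hkX : k ≤ (G.edgeInduce X).excess) (hXC : X ∉ G.kCircuits k) :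
    ∃ Y, Y ⊂ X ∧ k ≤ (G.edgeInduce Y).excess := by
  have hXf := hE.subset hX
  have hVf := G.vertexSet_edgeInduce_finite hXf
  have hEX : E(G.edgeInduce X) = X := Set.inter_eq_right.2 hX
  have hne : X.Nonempty := by
    by_contra h
    rw [Set.not_nonempty_iff_eq_empty] at h
    subst h
    simp only [excess_edgeInduce (Set.empty_subset _), Set.ncard_empty] at hkX
    omega
  by_cases h1 : (G.edgeInduce X).excess = k
  swap
  · obtain ⟨e, he⟩ := hne
    refine ⟨X \ {e}, Set.sdiff_singleton_ssubset.2 he, ?_⟩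
    rw [excess_edgeInduce (Set.sdiff_subset.trans hX)]
    rw [excess_edgeInduce hX] at h1 hkX
    have h2 := Set.ncard_sdiff_singleton_add_one he hXf
    have h3 := Set.ncard_le_ncard (vertexSet_edgeInduce_mono (G := G)
      (Set.sdiff_subset : X \ {e} ⊆ X)) hVf
    omega
  rw [excess_edgeInduce hX] at hkX
  by_cases h2 : ∃ v ∈ V(G.edgeInduce X), (G.edgeInduce X).degree v ≤ 1
  · obtain ⟨v, ⟨e, heX, hev⟩, hd⟩ := h2
    have hfin : ((G.edgeInduce X).incidenceSet v).Finite :=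
      hXf.subset fun f hf ↦ (edgeInduce_inc.1 hf).1
    have hmem : e ∈ (G.edgeInduce X).incidenceSet v := edgeInduce_inc.2 ⟨heX, hev⟩
    have hle : ((G.edgeInduce X).incidenceSet v).ncard ≤ 1 := by
      rw [degree] at hd; omega
    rw [Set.ncard_le_one hfin] at hle
    have hss : X \ {e} ⊂ X := Set.sdiff_singleton_ssubset.2 heX
    refine ⟨X \ {e}, hss, ?_⟩
    rw [excess_edgeInduce (hss.subset.trans hX)]
    have hvss : V(G.edgeInduce (X \ {e})) ⊂ V(G.edgeInduce X) := by
      refine (vertexSet_edgeInduce_mono hss.subset).ssubset_of_mem_notMem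
        (a := v) ⟨e, heX, hev⟩ ?_
      rintro ⟨f, ⟨hfX, hfe⟩, hfv⟩
      exact hfe (hle f (edgeInduce_inc.2 ⟨hfX, hfv⟩) e hmem)
    have h3 := Set.ncard_sdiff_singleton_add_one heX hXf
    have h4 := Set.ncard_lt_ncard hvss hVf
    omega
  push Not at h2
  have h3 : ∃ H : Graph α β, H.IsCycleComponent (G.edgeInduce X) := by
    by_contra h
    refine hXC ⟨hX, h1, fun v hv ↦ ?_, fun v hv ↦ ?_, h⟩
    · have := h2 v hv; omega
    · have := h2 v hv; omega
  obtain ⟨H, hHc, hH⟩ := h3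
  have hHX : E(H) ⊆ X := by simpa only [hEX] using hHc.le.edgeSet_mono
  have hHV := hHc.le.vertexSet_mono
  have hcard := hH.ncard_eq (hXf.subset hHX) (hVf.subset hHV)
  have hVpos : 0 < V(H).ncard := (Set.ncard_pos (hVf.subset hHV)).2 hH.1.1
  obtain ⟨e, he⟩ : E(H).Nonempty := (Set.ncard_pos (hXf.subset hHX)).1 (by omega)
  have hss : X \ E(H) ⊂ X := Set.sdiff_subset.ssubset_of_mem_notMem (hHX he) (fun h ↦ h.2 he)
  refine ⟨X \ E(H), hss, ?_⟩
  rw [excess_edgeInduce (hss.subset.trans hX)]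
  have hsub : V(G.edgeInduce (X \ E(H))) ⊆ V(G.edgeInduce X) \ V(H) := by
    rintro v ⟨f, ⟨hfX, hfH⟩, hfv⟩
    exact ⟨⟨f, hfX, hfv⟩, fun hv ↦ hfH (hHc.closed (edgeInduce_inc.2 ⟨hfX, hfv⟩) hv)⟩
  have h4 := Set.ncard_le_ncard hsub (hVf.subset Set.sdiff_subset)
  have h5 := Set.ncard_sdiff_add_ncard_of_subset hHV hVf
  have h6 := Set.ncard_sdiff_add_ncard_of_subset hHX hXf
  omega

theorem exists_kCircuit_subset (hE : E(G).Finite) {k : ℕ} (hk : 1 ≤ k)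
    (hX : X ⊆ E(G)) (hkX : k ≤ (G.edgeInduce X).excess) :
    ∃ C ∈ G.kCircuits k, C ⊆ X := by
  induction h : X.ncard using Nat.strong_induction_on generalizing X with
  | _ n ih =>
    by_cases hXC : X ∈ G.kCircuits k
    · exact ⟨X, hXC, subset_rfl⟩
    obtain ⟨Y, hYX, hkY⟩ := exists_ssubset_of_notMem_kCircuits hE hk hX hkX hXC
    obtain ⟨C, hC, hCY⟩ := ih Y.ncard (h ▸ Set.ncard_lt_ncard hYX (hE.subset hX))
      (hYX.subset.trans hX) hkY rfl
    exact ⟨C, hC, hCY.trans hYX.subset⟩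

theorem no_kCircuit_iff (hE : E(G).Finite) {k : ℕ} (hk : 1 ≤ k) (hX : X ⊆ E(G)) :
    (∀ C ∈ G.kCircuits k, ¬ C ⊆ X) ↔ ∀ Y ⊆ X, (G.edgeInduce Y).excess < k := by
  constructor
  · intro h Y hY
    by_contra! hlt
    obtain ⟨C, hC, hCY⟩ := exists_kCircuit_subset hE hk (hY.trans hX) hlt
    exact h C hC (hCY.trans hY)
  · intro h C hC hCX
    have := h C hCX
    rw [hC.2.1] at this
    exact lt_irrefl _ this

theorem kCircuits_augment (hE : E(G).Finite) {k : ℕ} (hk : 1 ≤ k) {I J : Set β}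
    (hIE : I ⊆ E(G)) (hJE : J ⊆ E(G)) (hI : ∀ C ∈ G.kCircuits k, ¬ C ⊆ I)
    (hJ : ∀ C ∈ G.kCircuits k, ¬ C ⊆ J) (hIJ : I.ncard < J.ncard) :
    ∃ e ∈ J, e ∉ I ∧ ∀ C ∈ G.kCircuits k, ¬ C ⊆ insert e I := by
  rw [no_kCircuit_iff hE hk hIE] at hI
  rw [no_kCircuit_iff hE hk hJE] at hJ
  have hIf := hE.subset hIE
  have hJf := hE.subset hJE
  by_contra! hcon
  -- every `e ∈ J \ I` has both ends in a tight subset of `I`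
  have key : ∀ e ∈ J, e ∉ I → ∃ Y ⊆ I, (G.edgeInduce Y).excess = k - 1 ∧
      ∀ v, G.Inc e v → v ∈ V(G.edgeInduce Y) := by
    intro e heJ heI
    obtain ⟨C, hC, hCI⟩ := hcon e heJ heI
    have heC : e ∈ C := by
      by_contra heC
      have hCI' : C ⊆ I := fun f hf ↦ (hCI hf).resolve_left (fun h ↦ heC (h ▸ hf))
      have := hI C hCI'
      rw [hC.2.1] at this
      exact lt_irrefl _ this
    have hYI : C \ {e} ⊆ I := fun f hf ↦ (hCI hf.1).resolve_left hf.2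
    have hCf := hE.subset hC.1
    have hlt := hI _ hYI
    have hCk := hC.2.1
    rw [excess_edgeInduce hC.1] at hCk
    rw [excess_edgeInduce (hYI.trans hIE)] at hlt
    have h1 := Set.ncard_sdiff_singleton_add_one heC hCf
    have hsub := vertexSet_edgeInduce_mono (G := G) (Set.sdiff_subset : C \ {e} ⊆ C)
    have h2 := Set.ncard_le_ncard hsub (G.vertexSet_edgeInduce_finite hCf)
    have heq : V(G.edgeInduce (C \ {e})) = V(G.edgeInduce C) :=
      Set.eq_of_subset_of_ncard_le hsub (by omega) (G.vertexSet_edgeInduce_finite hCf)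
    refine ⟨C \ {e}, hYI, ?_, fun v hv ↦ heq ▸ ⟨e, heC, hv⟩⟩
    rw [excess_edgeInduce (hYI.trans hIE)]
    rw [heq] at hlt ⊢
    omega
  obtain ⟨e₀, he₀J, he₀I⟩ : ∃ e ∈ J, e ∉ I := by
    by_contra! h
    exact absurd (Set.ncard_le_ncard h hIf) (by omega)
  -- a largest tight subset of `I`
  obtain ⟨T, ⟨hTI, hTk⟩, hTmax⟩ :=
    (hIf.finite_subsets.subset (t := {Y | Y ⊆ I ∧ (G.edgeInduce Y).excess = k - 1})
      (fun Y hY ↦ hY.1)).exists_maximal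
      (by obtain ⟨Y, hY, hYk, -⟩ := key e₀ he₀J he₀I; exact ⟨Y, hY, hYk⟩)
  have hTall : ∀ Y ⊆ I, (G.edgeInduce Y).excess = k - 1 → Y ⊆ T := by
    intro Y hYI hYk
    have h1 := excess_edgeInduce_supermodular hE (hTI.trans hIE) (hYI.trans hIE)
    have h2 := hI _ (Set.union_subset hTI hYI)
    have h3 := hI _ ((Set.inter_subset_left : T ∩ Y ⊆ T).trans hTI)
    have h4 : (G.edgeInduce (T ∪ Y)).excess = k - 1 := by omega
    exact Set.subset_union_right.trans
      (hTmax (y := T ∪ Y) ⟨Set.union_subset hTI hYI, h4⟩ Set.subset_union_left)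
  have hK : (J \ I) ∪ (J ∩ T) ⊆ J := Set.union_subset Set.sdiff_subset Set.inter_subset_left
  have hKlt := hJ _ hK
  have hVsub : V(G.edgeInduce ((J \ I) ∪ (J ∩ T))) ⊆ V(G.edgeInduce T) := by
    rintro v ⟨e, he | he, hev⟩
    · obtain ⟨Y, hYI, hYk, hY⟩ := key e he.1 he.2
      exact vertexSet_edgeInduce_mono (hTall Y hYI hYk) (hY v hev)
    · exact ⟨e, he.2, hev⟩
  have hVle := Set.ncard_le_ncard hVsub (G.vertexSet_edgeInduce_finite (hIf.subset hTI))
  rw [excess_edgeInduce (hK.trans hJE)] at hKlt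
  rw [excess_edgeInduce (hTI.trans hIE)] at hTk
  have hdisj : Disjoint (J \ I) (J ∩ T) :=
    Set.disjoint_left.2 fun e he he' ↦ he.2 (hTI he'.2)
  rw [Set.ncard_union_eq hdisj (hJf.subset Set.sdiff_subset)
    (hJf.subset Set.inter_subset_left)] at hKlt
  have h1 := Set.ncard_inter_add_ncard_sdiff_eq_ncard T J (hIf.subset hTI)
  have h2 := Set.ncard_inter_add_ncard_sdiff_eq_ncard I J hIf
  have h3 := Set.ncard_inter_add_ncard_sdiff_eq_ncard J I hJf
  have h4 : (T \ J).ncard ≤ (I \ J).ncard :=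
    Set.ncard_le_ncard (Set.sdiff_subset_sdiff_left hTI) (hIf.subset Set.sdiff_subset)
  have h5 : (J ∩ T).ncard = (T ∩ J).ncard := by rw [Set.inter_comm]
  have h6 : (J ∩ I).ncard = (I ∩ J).ncard := by rw [Set.inter_comm]
  omega

/-- No proper subset of a member of `𝓒ₖ(G)` has excess at least `k`. -/
theorem excess_lt_of_ssubset_kCircuit (hE : E(G).Finite) {k : ℕ} {C : Set β}
    (hC : C ∈ G.kCircuits k) (hYC : Y ⊂ C) : (G.edgeInduce Y).excess < k := by
  classical
  obtain ⟨hCE, hCk, hd0, hd1, hcyc⟩ := hC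
  by_contra! hlt
  have hCf := hE.subset hCE
  have hVf := G.vertexSet_edgeInduce_finite hCf
  have hVmono := vertexSet_edgeInduce_mono (G := G) hYC.subset
  have hEC : E(G.edgeInduce C) = C := Set.inter_eq_right.2 hCE
  have hECf : E(G.edgeInduce C).Finite := hEC.symm ▸ hCf
  rw [excess_edgeInduce hCE] at hCk
  rw [excess_edgeInduce (hYC.subset.trans hCE)] at hlt
  set H := G.edgeInduce C with hH
  have hWf : (V(H) \ V(G.edgeInduce Y)).Finite := hVf.subset Set.sdiff_subset
  set W := hWf.toFinset with hW
  have hDf : (C \ Y).Finite := hCf.subset Set.sdiff_subset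
  have hmemW : ∀ v, v ∈ W ↔ v ∈ V(H) ∧ v ∉ V(G.edgeInduce Y) := fun v ↦ by simp [hW]
  have hsum : ∑ v ∈ W, H.degree v = ∑ e ∈ hDf.toFinset, H.endCount W e := by
    rw [sum_degree_eq hECf]
    symm
    refine Finset.sum_subset (fun e he ↦ ?_) (fun e he he' ↦ ?_)
    · simp only [Set.Finite.mem_toFinset] at he ⊢
      exact hEC.symm ▸ he.1
    · simp only [Set.Finite.mem_toFinset, hEC, Set.mem_sdiff, not_and, not_not] at he he'
      obtain ⟨x, y, hxy⟩ := H.exists_isLink_of_mem_edgeSet (hEC.symm ▸ he)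
      have hx : x ∉ W :=
        fun h ↦ ((hmemW x).1 h).2 ⟨e, he' he, (edgeInduce_inc.1 hxy.inc_left).2⟩
      have hy : y ∉ W :=
        fun h ↦ ((hmemW y).1 h).2 ⟨e, he' he, (edgeInduce_inc.1 hxy.inc_right).2⟩
      rw [endCount_eq hxy, if_neg hx, if_neg hy]
      exact Nat.add_zero 0
  have hdeg : ∀ v ∈ W, 2 ≤ H.degree v := by
    intro v hv
    have h0 := hd0 v ((hmemW v).1 hv).1
    have h1 := hd1 v ((hmemW v).1 hv).1
    omega
  have hend : ∀ e ∈ hDf.toFinset, H.endCount W e ≤ 2 := by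
    intro e he
    simp only [Set.Finite.mem_toFinset] at he
    obtain ⟨x, y, hxy⟩ := H.exists_isLink_of_mem_edgeSet (hEC.symm ▸ he.1)
    rw [endCount_eq hxy]
    split_ifs <;> omega
  have hle1 := Finset.sum_le_sum hdeg
  have hle2 := Finset.sum_le_sum hend
  have hWc : W.card = (V(H) \ V(G.edgeInduce Y)).ncard :=
    (Set.ncard_eq_toFinset_card _ hWf).symm
  have hDc : hDf.toFinset.card = (C \ Y).ncard := (Set.ncard_eq_toFinset_card _ hDf).symm
  have h5 := Set.ncard_sdiff_add_ncard_of_subset hVmono hVf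
  have h6 := Set.ncard_sdiff_add_ncard_of_subset hYC.subset hCf
  have hWD : hDf.toFinset.card ≤ W.card := by omega
  have hc1 : ∑ v ∈ W, 2 = 2 * W.card := by simp [mul_comm]
  have hc2 : ∑ e ∈ hDf.toFinset, 2 = 2 * hDf.toFinset.card := by simp [mul_comm]
  have hdeg2 := (Finset.sum_eq_sum_iff_of_le hdeg).1 (by omega)
  have hend2 := (Finset.sum_eq_sum_iff_of_le hend).1 (by omega)
  have hstep : ∀ e x y, H.IsLink e x y → e ∉ Y → x ∈ W ∧ y ∈ W := by
    intro e x y hxy heY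
    have h := hend2 e (by simpa using ⟨hEC ▸ hxy.edge_mem, heY⟩)
    rw [endCount_eq hxy] at h
    split_ifs at h with h1 h2 h2
    · exact ⟨h1, h2⟩
    all_goals omega
  obtain ⟨e, heC, heY⟩ := Set.exists_of_ssubset hYC
  obtain ⟨x, y, hxy⟩ := H.exists_isLink_of_mem_edgeSet (hEC.symm ▸ heC)
  have hR : ∀ z, Relation.ReflTransGen H.Adj x z → z ∈ W := by
    intro z hz
    induction hz with
    | refl => exact (hstep e x y hxy heY).1
    | tail _ hab ih =>
      obtain ⟨f, hf⟩ := hab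
      refine (hstep f _ _ hf fun hfY ↦ ?_).2
      exact ((hmemW _).1 ih).2 ⟨f, hfY, (edgeInduce_inc.1 hf.inc_left).2⟩
  set R : Set α := {z | Relation.ReflTransGen H.Adj x z} with hRdef
  have hRV : R ⊆ V(H) := fun z hz ↦ ((hmemW z).1 (hR z hz)).1
  have hKc : H.induce R ≤c H := by
    refine IsClosedSubgraph.mk' (induce_le hRV) fun f v hfv hv ↦ ?_
    obtain ⟨w, hw⟩ := hfv
    exact ⟨v, w, hw, hv, Relation.ReflTransGen.tail hv ⟨f, hw⟩⟩
  have hreach : ∀ z, Relation.ReflTransGen H.Adj x z →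
      Relation.ReflTransGen (H.induce R).Adj x z := by
    intro z hz
    induction hz with
    | refl => exact Relation.ReflTransGen.refl
    | tail ha hab ih =>
      obtain ⟨f, hf⟩ := hab
      exact ih.tail ⟨f, hf, ha, ha.tail ⟨f, hf⟩⟩
  refine hcyc ⟨H.induce R, hKc, ⟨⟨x, Relation.ReflTransGen.refl⟩, fun a ha b hb ↦ ?_⟩,
    fun v hv ↦ ?_⟩
  · exact (Std.Symm.symm _ _ (hreach a ha)).trans
      (hreach b hb)
  · have h1 : (H.induce R).incidenceSet v = H.incidenceSet v :=
      Set.ext fun f ↦ hKc.inc_congr hv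
    have h2 : (H.induce R).loopSet v = H.loopSet v :=
      Set.ext fun f ↦ hKc.isLink_congr hv
    rw [degree, h1, h2]
    exact (hdeg2 v (hR v hv)).symm

end Aux

/-! ### The `k`-circular matroid -/

/-- The `k`-circular matroid `Mₖ(G)` of a graph `G` with finitely many edges, `k ≥ 1`: the matroid
on `E(G)` whose independent sets are the edge sets that contain no member of `𝓒ₖ(G)`. -/
def kCircularMatroid (G : Graph α β) (hE : E(G).Finite) (k : ℕ) (hk : 1 ≤ k) : Matroid β :=
  (IndepMatroid.ofFinite hE (fun I ↦ I ⊆ E(G) ∧ ∀ C ∈ G.kCircuits k, ¬ C ⊆ I)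
    ⟨Set.empty_subset _, by
      rw [no_kCircuit_iff hE hk (Set.empty_subset _)]
      intro Y hY
      obtain rfl := Set.subset_empty_iff.1 hY
      rw [excess_edgeInduce (Set.empty_subset _), Set.ncard_empty]
      omega⟩
    (fun _ _ hJ hIJ ↦ ⟨hIJ.trans hJ.1, fun C hC hCI ↦ hJ.2 C hC (hCI.trans hIJ)⟩)
    (fun I J hI hJ hIJ ↦ by
      obtain ⟨e, heJ, heI, he⟩ := kCircuits_augment hE hk hI.1 hJ.1 hI.2 hJ.2 hIJ
      exact ⟨e, heJ, heI, Set.insert_subset (hJ.1 heJ) hI.1, he⟩)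
    (fun _ hI ↦ hI.1)).matroid

theorem kCircularMatroid_indep_iff (G : Graph α β) (hE : E(G).Finite) (k : ℕ) (hk : 1 ≤ k)
    (I : Set β) : (G.kCircularMatroid hE k hk).Indep I ↔
      I ⊆ E(G) ∧ ∀ C ∈ G.kCircuits k, ¬ C ⊆ I := by
  simp [kCircularMatroid]

/-- The circuits of `Mₖ(G)` are the members of `𝓒ₖ(G)`. -/
theorem kCircularMatroid_isCircuit_iff (G : Graph α β) (hE : E(G).Finite) (k : ℕ) (hk : 1 ≤ k)
    (C : Set β) : (G.kCircularMatroid hE k hk).IsCircuit C ↔ C ∈ G.kCircuits k := by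
  have hdep : ∀ X, (G.kCircularMatroid hE k hk).Dep X ↔
      X ⊆ E(G) ∧ ∃ C ∈ G.kCircuits k, C ⊆ X := by
    intro X
    have hgr : (G.kCircularMatroid hE k hk).E = E(G) := by simp [kCircularMatroid]
    rw [Matroid.Dep, kCircularMatroid_indep_iff, hgr]
    grind
  constructor
  · intro h
    obtain ⟨hCE, D, hD, hDC⟩ := (hdep C).1 h.dep
    have := h.eq_of_dep_subset ((hdep D).2 ⟨hD.1, D, hD, subset_rfl⟩) hDC
    exact this ▸ hD
  · intro hC
    refine ⟨(hdep C).2 ⟨hC.1, C, hC, subset_rfl⟩, fun X hX hXC ↦ ?_⟩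
    obtain ⟨-, D, hD, hDX⟩ := (hdep X).1 hX
    by_contra hne
    have hlt := excess_lt_of_ssubset_kCircuit hE hC
      (⟨hDX.trans hXC, fun h ↦ hne (h.trans hDX)⟩ : D ⊂ C)
    rw [hD.2.1] at hlt
    exact lt_irrefl _ hlt

/-- The corank `ρ*ₖ(G)`: the rank of the dual of `Mₖ(G)`. -/
noncomputable def kCorank (G : Graph α β) (hE : E(G).Finite) (k : ℕ) (hk : 1 ≤ k) : ℕ∞ :=
  (G.kCircularMatroid hE k hk)✶.eRank

/-! ### Stars, connectivity and strong isomorphism -/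

/-- The size `s(v, G)` of the vertex star `S(v, G)`, the set of edges incident to `v`. -/
noncomputable def starSize (G : Graph α β) (v : α) : ℕ∞ := (G.incidenceSet v).encard

/-- The set `𝓢(G)` of the vertex stars of `G`. -/
def starFamily (G : Graph α β) : Set (Set β) := {S | ∃ v ∈ V(G), S = G.incidenceSet v}

/-- `v` is `k`-small in `G`. -/
def IsKSmall (G : Graph α β) (hE : E(G).Finite) (k : ℕ) (hk : 1 ≤ k) (v : α) : Prop :=
  G.starSize v < G.kCorank hE k hk + 1

/-- `v` is `k`-tight in `G`. -/
def IsKTight (G : Graph α β) (hE : E(G).Finite) (k : ℕ) (hk : 1 ≤ k) (v : α) : Prop :=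
  G.starSize v = G.kCorank hE k hk + 1

/-- `G` is `3`-connected: it has no loops and at least four vertices, and the deletion of any set of
at most two vertices leaves a connected graph. Parallel edges are allowed. -/
def IsThreeConnected (G : Graph α β) : Prop :=
  G.Loopless ∧ 4 ≤ V(G).encard ∧
    ∀ X ⊆ V(G), X.encard ≤ 2 → (G.deleteVerts X).Connected

/-- `G` and `G'` have the same edges, and some bijection between their vertex sets
carries the ends of each edge in `G` to its ends in `G'`. -/
def StronglyIsomorphic (G : Graph α β) (G' : Graph α' β) : Prop :=
  E(G) = E(G') ∧ ∃ ν : V(G) ≃ V(G'), ∀ (e : β) (x y : V(G)),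
    G.IsLink e x y ↔ G'.IsLink e (ν x) (ν y)

end Graph

namespace Graph

/-! ### Maximum excess as a matroid quantity -/

section Excess

variable {α α' β : Type*} {G : Graph α β} {G' : Graph α' β} {X Y I : Set β} {k : ℕ} {e : β}

/-! The matroid sees excess through a min-max formula: the nullity of a set `X` in $M_k(G)$ is
$\max(0, m - (k-1))$, where $m$ is the largest excess of a subset of `X`. So a bound at least $k-1$
on the excess of all subsets of `X` holds in `G` iff it holds in `G'` (`excess_le_of_kCircuits_eq`).
If `X` is the unique maximizer among its subsets and has excess at least $k$, its excess is the same
in both graphs (`excess_eq_of_kCircuits_eq`).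

Since `G` and each $G - x$ are 2-connected, their full edge sets are such unique maximizers when
their excess is positive (`excess_lt_of_ssubset`). Applied to $E(G)$, this gives $|V(G')| = |V(G)|$.
As $\rho^*_k = |E| - |V| - k + 1$, small vertices are those for which $G - x$ has excess at least
$k$, and tight ones those for which it has excess $k-1$. For small `x`, equality of excess makes
$E(G-x)$ miss a vertex `v` of `G'`, so the star of `v` lies in that of `x`. Conversely, an edge at
`x` adds the vertex `x` in `G`, so adding it to $E(G-x)$ creates no larger excess; an edge avoiding
`v` would create one in `G'`.

For `t` only the bound $k-1$ transfers. But the stars already found account for both ends of every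
edge of $G - t$, so these edges miss the one vertex left over in `G'`, and the last argument applies
again. -/

theorem excess_edgeInduce_empty (G : Graph α β) : (G.edgeInduce (∅ : Set β)).excess = 0 := by
  have hV : V(G.edgeInduce (∅ : Set β)) = ∅ := by
    ext v; simp [edgeInduce]
  simp [excess_edgeInduce (Set.empty_subset E(G)), hV]

/-- A set attaining the maximum excess among the subsets of `X`, of least size: deleting one of its
elements from `X` lowers the maximum. -/
theorem exists_mem_forall_excess_lt (hE : E(G).Finite) (hX : X ⊆ E(G)) {m : ℤ} (hm : 0 < m)
    (hle : ∀ Y ⊆ X, (G.edgeInduce Y).excess ≤ m) (hY : Y ⊆ X) (hYm : (G.edgeInduce Y).excess = m) :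
    ∃ e ∈ X, ∀ Z ⊆ X \ {e}, (G.edgeInduce Z).excess < m := by
  obtain ⟨Z, ⟨hZX, hZm⟩, hmin⟩ :=
    ((hE.subset hX).finite_subsets.subset (t := {Z | Z ⊆ X ∧ (G.edgeInduce Z).excess = m})
      (fun Z hZ ↦ hZ.1)).exists_minimal ⟨Y, hY, hYm⟩
  obtain ⟨e, he⟩ : Z.Nonempty := by
    by_contra h
    rw [Set.not_nonempty_iff_eq_empty] at h
    rw [h, excess_edgeInduce_empty] at hZm
    omega
  refine ⟨e, hZX he, fun W hW ↦ lt_of_le_of_ne (hle W (hW.trans Set.sdiff_subset)) fun hWm ↦ ?_⟩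
  have hWX := hW.trans Set.sdiff_subset
  -- By supermodularity the sets attaining the maximum are closed under intersection. Minimality
  -- then puts `Z` inside `W`, which avoids `e`.
  have h1 := excess_edgeInduce_supermodular hE (hZX.trans hX) (hWX.trans hX)
  have h2 := hle _ (Set.union_subset hZX hWX)
  have h3 := hle _ ((Set.inter_subset_left : Z ∩ W ⊆ Z).trans hZX)
  have h4 := hmin (y := Z ∩ W) ⟨Set.inter_subset_left.trans hZX, by omega⟩ Set.inter_subset_left
  exact (hW (h4 he).2).2 rfl

/-- If all subsets of `X` have excess at most `m ≥ k - 1`, one can delete `m - (k - 1)` elements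
of `X` so that no member of `𝓒ₖ(G)` is left. -/
theorem exists_subset_no_kCircuit (hE : E(G).Finite) (hk : 1 ≤ k) (hX : X ⊆ E(G)) (n : ℕ)
    (hle : ∀ Y ⊆ X, (G.edgeInduce Y).excess ≤ k - 1 + n) :
    ∃ I ⊆ X, (∀ C ∈ G.kCircuits k, ¬ C ⊆ I) ∧ X.ncard ≤ I.ncard + n := by
  induction n generalizing X with
  | zero =>
    refine ⟨X, subset_rfl, (no_kCircuit_iff hE hk hX).2 fun Y hY ↦ ?_, le_rfl⟩
    have := hle Y hY
    push_cast at this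
    omega
  | succ n ih =>
    by_cases h : ∃ Y ⊆ X, (G.edgeInduce Y).excess = k - 1 + (n + 1 : ℕ)
    · obtain ⟨Y, hY, hYm⟩ := h
      obtain ⟨e, he, hlt⟩ := exists_mem_forall_excess_lt hE hX (by push_cast; omega) hle hY hYm
      obtain ⟨I, hI, hIC, hcard⟩ := ih (X := X \ {e}) (Set.sdiff_subset.trans hX) fun Z hZ ↦ by
        have := hlt Z hZ
        push_cast at this
        omega
      have := Set.ncard_sdiff_singleton_add_one he (hE.subset hX)
      exact ⟨I, hI.trans Set.sdiff_subset, hIC, by omega⟩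
    -- The bound is not attained, so it drops by one without a deletion.
    · push Not at h
      obtain ⟨I, hI, hIC, hcard⟩ := ih hX fun Z hZ ↦ by
        have h1 := hle Z hZ
        have h2 := h Z hZ
        push_cast at h1 h2
        omega
      exact ⟨I, hI, hIC, by omega⟩

/-- The part of `Y` inside `I` has excess at most $k-1$, and each of the at most $|X \setminus I|$
other edges of `Y` raises the excess by at most one. This is the converse half of the min-max
formula. -/
theorem ncard_add_excess_le (hE : E(G).Finite) (hk : 1 ≤ k) (hX : X ⊆ E(G)) (hI : I ⊆ X)
    (hIC : ∀ C ∈ G.kCircuits k, ¬ C ⊆ I) (hY : Y ⊆ X) :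
    I.ncard + (G.edgeInduce Y).excess ≤ X.ncard + k - 1 := by
  have h1 := (no_kCircuit_iff hE hk (hI.trans hX)).1 hIC (I ∩ Y) Set.inter_subset_left
  have hXf := hE.subset hX
  have hYf := hXf.subset hY
  rw [excess_edgeInduce (Set.inter_subset_left.trans (hI.trans hX))] at h1
  rw [excess_edgeInduce (hY.trans hX)]
  have h2 := Set.ncard_le_ncard (vertexSet_edgeInduce_mono (G := G)
    (Set.inter_subset_right : I ∩ Y ⊆ Y)) (G.vertexSet_edgeInduce_finite hYf)
  have h3 := Set.ncard_inter_add_ncard_sdiff_eq_ncard I Y (hXf.subset hI)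
  have h4 := Set.ncard_le_ncard (Set.sdiff_subset_sdiff_left hI : I \ Y ⊆ X \ Y)
    (hXf.subset Set.sdiff_subset)
  have h5 := Set.ncard_sdiff_add_ncard_of_subset hY hXf
  omega

/-- Bounds `m ≥ k - 1` on the excess of the subsets of `X` depend on `𝓒ₖ(G)` only. -/
theorem excess_le_of_kCircuits_eq (hE : E(G).Finite) (hE' : E(G').Finite) (hk : 1 ≤ k)
    (hEE : E(G') = E(G)) (hC : G'.kCircuits k = G.kCircuits k) (hX : X ⊆ E(G)) {m : ℤ}
    (hm : (k : ℤ) - 1 ≤ m) (hle : ∀ Y ⊆ X, (G.edgeInduce Y).excess ≤ m) (hY : Y ⊆ X) :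
    (G'.edgeInduce Y).excess ≤ m := by
  obtain ⟨n, rfl⟩ : ∃ n : ℕ, m = k - 1 + n := ⟨(m - (k - 1)).toNat, by omega⟩
  obtain ⟨I, hI, hIC, hcard⟩ := exists_subset_no_kCircuit hE hk hX n hle
  have := ncard_add_excess_le hE' hk (hEE.symm ▸ hX) hI (hC.symm ▸ hIC) hY
  omega

/-- Both the maximum over subsets of `X` and its drop after deleting any edge are matroid data. If
`X` had smaller excess in `G'`, no subset would attain the maximum there, and the lower bound would
transfer back to `G`. That lower bound is still at least $k-1$ because `X` has excess at least $k$.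
-/
theorem excess_eq_of_kCircuits_eq (hE : E(G).Finite) (hE' : E(G').Finite) (hk : 1 ≤ k)
    (hEE : E(G') = E(G)) (hC : G'.kCircuits k = G.kCircuits k) (hX : X ⊆ E(G))
    (hkX : k ≤ (G.edgeInduce X).excess)
    (hlt : ∀ Y, Y ⊂ X → (G.edgeInduce Y).excess < (G.edgeInduce X).excess) :
    (G'.edgeInduce X).excess = (G.edgeInduce X).excess := by
  have hle : ∀ Y ⊆ X, (G.edgeInduce Y).excess ≤ (G.edgeInduce X).excess := by
    intro Y hY
    obtain rfl | h := hY.eq_or_ssubset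
    exacts [le_rfl, (hlt Y h).le]
  refine le_antisymm
    (excess_le_of_kCircuits_eq hE hE' hk hEE hC hX (by omega) hle subset_rfl) ?_
  by_contra! h
  have hle' : ∀ Y ⊆ X, (G'.edgeInduce Y).excess ≤ (G.edgeInduce X).excess - 1 := by
    intro Y hY
    obtain rfl | hYX := hY.eq_or_ssubset
    · omega
    obtain ⟨e, heX, heY⟩ := Set.exists_of_ssubset hYX
    refine excess_le_of_kCircuits_eq (X := X \ {e}) hE hE' hk hEE hC (Set.sdiff_subset.trans hX)
      (by omega) (fun Z hZ ↦ ?_) (Set.subset_sdiff_singleton hY heY)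
    have := hlt Z (hZ.trans_ssubset (Set.sdiff_singleton_ssubset.2 heX))
    omega
  have := excess_le_of_kCircuits_eq hE' hE hk hEE.symm hC.symm (hEE.symm ▸ hX) (by omega) hle'
    subset_rfl
  omega

/-- The min-max formula with maximizer $E(G)$: the rank is $|E|$ minus the excess surplus over
$k-1$. -/
theorem eRank_kCircularMatroid (hE : E(G).Finite) (hk : 1 ≤ k)
    (hle : ∀ Y ⊆ E(G), (G.edgeInduce Y).excess ≤ (G.edgeInduce E(G)).excess)
    (hkE : (k : ℤ) - 1 ≤ (G.edgeInduce E(G)).excess) :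
    (G.kCircularMatroid hE k hk).eRank = (V(G.edgeInduce E(G)).ncard + k - 1 : ℕ) := by
  have hex := excess_edgeInduce (G := G) (subset_refl E(G))
  obtain ⟨n, hn⟩ : ∃ n : ℕ, (G.edgeInduce E(G)).excess = k - 1 + n :=
    ⟨((G.edgeInduce E(G)).excess - (k - 1)).toNat, by omega⟩
  obtain ⟨I, hI, hIC, hcard⟩ := exists_subset_no_kCircuit hE hk subset_rfl n (hn ▸ hle)
  refine le_antisymm ?_ ?_
  · obtain ⟨B, hB⟩ := (G.kCircularMatroid hE k hk).exists_isBase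
    obtain ⟨hBE, hBC⟩ := (kCircularMatroid_indep_iff G hE k hk B).1 hB.indep
    have := ncard_add_excess_le hE hk subset_rfl hBE hBC subset_rfl
    rw [← hB.encard_eq_eRank, ← (hE.subset hBE).cast_ncard_eq, Nat.cast_le]
    omega
  · have := ((kCircularMatroid_indep_iff G hE k hk I).2 ⟨hI, hIC⟩).encard_le_eRank
    rw [← (hE.subset hI).cast_ncard_eq] at this
    refine le_trans ?_ this
    rw [Nat.cast_le]
    omega

end Excess

/-! ### Excess in a 3-connected graph after deleting vertices -/

section ThreeConnected

variable {α α' β : Type*} {G : Graph α β} {G' : Graph α' β} {D S : Set α} {Y : Set β}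
  {x y : α} {e : β} {k : ℕ}

theorem Connected.exists_isLink (h : G.Connected) (hx : x ∈ V(G)) (hxS : x ∈ S) (hy : y ∈ V(G))
    (hyS : y ∉ S) : ∃ e a b, G.IsLink e a b ∧ a ∈ S ∧ b ∉ S := by
  by_contra! hcon
  have key : ∀ z, Relation.ReflTransGen G.Adj x z → z ∈ S := by
    intro z hz
    induction hz with
    | refl => exact hxS
    | tail _ hab ih =>
      obtain ⟨f, hf⟩ := hab
      exact hcon f _ _ hf ih
  exact hyS (key y (h.2 x hx y hy))

theorem mem_edgeSet_deleteVerts_singleton :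
    e ∈ E(G.deleteVerts {x}) ↔ e ∈ E(G) ∧ ¬ G.Inc e x := by
  rw [edgeSet_deleteVerts]
  constructor
  · rintro ⟨a, b, hab, ha, hb⟩
    refine ⟨hab.edge_mem, fun hx ↦ ?_⟩
    obtain rfl | rfl := hx.eq_or_eq_of_isLink hab
    exacts [ha rfl, hb rfl]
  · rintro ⟨he, hx⟩
    obtain ⟨a, b, hab⟩ := G.exists_isLink_of_mem_edgeSet he
    exact ⟨a, b, hab, fun h ↦ hx (h ▸ hab.inc_left), fun h ↦ hx (h ▸ hab.inc_right)⟩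

theorem ncard_incidenceSet_add_ncard_edgeSet_deleteVerts (hE : E(G).Finite) (x : α) :
    (G.incidenceSet x).ncard + E(G.deleteVerts {x}).ncard = E(G).ncard := by
  have : E(G.deleteVerts {x}) = E(G) \ G.incidenceSet x := by
    ext e
    exact mem_edgeSet_deleteVerts_singleton
  rw [this, add_comm]
  exact Set.ncard_sdiff_add_ncard_of_subset (G.incidenceSet_subset_edgeSet x) hE

namespace IsThreeConnected

theorem exists_notMem (h : G.IsThreeConnected) (hS : S.encard ≤ 3) : ∃ v ∈ V(G), v ∉ S := by
  by_contra! hcon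
  have h1 := h.2.1.trans ((Set.encard_le_encard hcon).trans hS)
  exact absurd h1 (by decide)

/-- A vertex outside a set `D` of at most two vertices has a neighbour outside `D`. -/
theorem exists_isLink (h : G.IsThreeConnected) (hD : D ⊆ V(G)) (hD2 : D.encard ≤ 2)
    (hx : x ∈ V(G)) (hxD : x ∉ D) : ∃ e y, G.IsLink e x y ∧ y ∉ D := by
  obtain ⟨v, hv, hvS⟩ := h.exists_notMem (S := insert x D)
    ((Set.encard_insert_le D x).trans (by
      calc D.encard + 1 ≤ 2 + 1 := by gcongr
        _ = 3 := by norm_num))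
  obtain ⟨f, a, b, hab, ha, -⟩ := (h.2.2 D hD hD2).exists_isLink (S := {x}) (x := x) (y := v)
    (by simp [hx, hxD]) rfl (by simp only [vertexSet_deleteVerts]; grind) (by grind)
  rw [deleteVerts_isLink] at hab
  obtain rfl : a = x := ha
  exact ⟨f, b, hab.1, hab.2.2⟩

/-- No vertex of $G - D$ is isolated, so its excess can be read off from its edge set. -/
theorem vertexSet_edgeInduce_edgeSet_deleteVerts (h : G.IsThreeConnected) (hD : D ⊆ V(G))
    (hD2 : D.encard ≤ 2) : V(G.edgeInduce E(G.deleteVerts D)) = V(G) \ D := by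
  ext v
  constructor
  · rintro ⟨e, he, hev⟩
    rw [edgeSet_deleteVerts] at he
    obtain ⟨a, b, hab, ha, hb⟩ := he
    refine ⟨hev.vertex_mem, ?_⟩
    obtain rfl | rfl := hev.eq_or_eq_of_isLink hab
    exacts [ha, hb]
  · rintro ⟨hv, hvD⟩
    obtain ⟨e, y, hey, hy⟩ := h.exists_isLink hD hD2 hv hvD
    refine ⟨e, ?_, hey.inc_left⟩
    rw [edgeSet_deleteVerts]
    exact ⟨v, y, hey, hvD, hy⟩

theorem excess_edgeSet_deleteVerts (h : G.IsThreeConnected) (hD : D ⊆ V(G))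
    (hD2 : D.encard ≤ 2) : (G.edgeInduce E(G.deleteVerts D)).excess =
      (E(G.deleteVerts D).ncard : ℤ) - ((V(G) \ D).ncard : ℤ) := by
  rw [excess_edgeInduce deleteVerts_le.edgeSet_mono,
    h.vertexSet_edgeInduce_edgeSet_deleteVerts hD hD2]

/-- In a `2`-connected graph `G - D`, proper nonempty sets of edges have smaller excess than the
set of all edges. -/
theorem excess_lt_of_ssubset (h : G.IsThreeConnected) (hE : E(G).Finite) (hD : D ⊆ V(G))
    (hD1 : D.encard ≤ 1) (hY : Y ⊂ E(G.deleteVerts D)) (hne : Y.Nonempty) :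
    (G.edgeInduce Y).excess < (G.edgeInduce E(G.deleteVerts D)).excess := by
  have hD2 : D.encard ≤ 2 := hD1.trans (by norm_num)
  set F := E(G.deleteVerts D) with hF
  have hFE : F ⊆ E(G) := deleteVerts_le.edgeSet_mono
  have hFf := hE.subset hFE
  have hVF := h.vertexSet_edgeInduce_edgeSet_deleteVerts hD hD2
  by_contra! hlt
  -- Take a maximal counterexample `Z`. It cannot span: with the same vertices and fewer edges its
  -- excess would be smaller.
  obtain ⟨Z, ⟨hZF, hZne, hZ⟩, hmax⟩ := (hFf.finite_subsets.subset
    (t := {Z | Z ⊂ F ∧ Z.Nonempty ∧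
      (G.edgeInduce F).excess ≤ (G.edgeInduce Z).excess}) (fun Z hZ ↦ hZ.1.subset)).exists_maximal
    ⟨Y, hY, hne, hlt⟩
  have hZE := hZF.subset.trans hFE
  have hZf := hE.subset hZE
  have hVsub := vertexSet_edgeInduce_mono (G := G) hZF.subset
  have hcard := Set.ncard_lt_ncard hZF hFf
  obtain ⟨w, hwF, hwZ⟩ : ∃ w ∈ V(G.edgeInduce F), w ∉ V(G.edgeInduce Z) := by
    by_contra! hcon
    have := Set.ncard_le_ncard hcon (G.vertexSet_edgeInduce_finite hZf)
    rw [excess_edgeInduce hFE, excess_edgeInduce hZE] at hZ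
    omega
  obtain ⟨e₀, he₀⟩ := hZne
  obtain ⟨v, v', hv⟩ := G.exists_isLink_of_mem_edgeSet (hZE he₀)
  have hvZ : v ∈ V(G.edgeInduce Z) := ⟨e₀, he₀, hv.inc_left⟩
  have hvF := hVsub hvZ
  rw [hVF] at hwF hvF
  obtain ⟨e, a, b, hab, haZ, hbZ⟩ := (h.2.2 D hD hD2).exists_isLink
    (by rw [vertexSet_deleteVerts]; exact hvF) hvZ (by rw [vertexSet_deleteVerts]; exact hwF) hwZ
  have heF : e ∈ F := hab.edge_mem
  rw [deleteVerts_isLink] at hab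
  obtain ⟨hab, haD, hbD⟩ := hab
  have heZ : e ∉ Z := fun he ↦ hbZ ⟨e, he, hab.inc_right⟩
  have hins : insert e Z ⊆ F := Set.insert_subset heF hZF.subset
  -- The edge `e` leaving $V(Z)$ brings at most one new vertex, so adding it does not lower the
  -- excess; maximality leaves only $Z + e = F$.
  have heq : insert e Z = F := by
    by_contra hneq
    have hVins : V(G.edgeInduce (insert e Z)) ⊆ insert b V(G.edgeInduce Z) := by
      rintro u ⟨f, rfl | hf, hu⟩
      · obtain rfl | rfl := hu.eq_or_eq_of_isLink hab
        exacts [.inr haZ, .inl rfl]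
      · exact .inr ⟨f, hf, hu⟩
    have h1 := Set.ncard_le_ncard hVins ((G.vertexSet_edgeInduce_finite hZf).insert b)
    have h2 := Set.ncard_insert_le b V(G.edgeInduce Z)
    have h3 := Set.ncard_insert_of_notMem heZ hZf
    refine heZ (hmax (y := insert e Z) ⟨hins.ssubset_of_ne hneq, Set.insert_nonempty e Z, ?_⟩
      (Set.subset_insert e Z) (Set.mem_insert e Z))
    refine hZ.trans ?_
    rw [excess_edgeInduce hZE, excess_edgeInduce (hins.trans hFE)]
    omega
  -- Deleting `a` as well as `D` still leaves `b` a neighbour, so `b` meets an edge of `F` other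
  -- than `e`, hence an edge of `Z`.
  obtain ⟨f, c, hbc, hc⟩ := h.exists_isLink (D := insert a D) (x := b)
    (Set.insert_subset hab.left_mem hD)
    ((Set.encard_insert_le D a).trans (by
      calc D.encard + 1 ≤ 1 + 1 := by gcongr
        _ = 2 := by norm_num)) hab.right_mem (by
      rintro (rfl | hb)
      exacts [hbZ haZ, hbD hb])
  have hfF : f ∈ insert e Z := by
    rw [heq, hF, edgeSet_deleteVerts]
    exact ⟨b, c, hbc, hbD, fun hcD ↦ hc (.inr hcD)⟩
  obtain rfl | hf := hfF
  · exact hc (.inl (hbc.right_unique hab.symm))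
  · exact hbZ ⟨f, hf, hbc.inc_left⟩

/-- The `max 0` accounts for the empty set, which has excess 0. -/
theorem excess_le (h : G.IsThreeConnected) (hE : E(G).Finite) (hD : D ⊆ V(G))
    (hD1 : D.encard ≤ 1) (hY : Y ⊆ E(G.deleteVerts D)) :
    (G.edgeInduce Y).excess ≤ max 0 (G.edgeInduce E(G.deleteVerts D)).excess := by
  obtain rfl | hne := Y.eq_empty_or_nonempty
  · rw [excess_edgeInduce_empty]
    exact le_max_left _ _
  obtain rfl | hss := hY.eq_or_ssubset
  · exact le_max_right _ _
  · exact (h.excess_lt_of_ssubset hE hD hD1 hss hne).le.trans (le_max_right _ _)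

theorem excess_lt_of_ssubset_of_pos (h : G.IsThreeConnected) (hE : E(G).Finite) (hD : D ⊆ V(G))
    (hD1 : D.encard ≤ 1) (hpos : 0 < (G.edgeInduce E(G.deleteVerts D)).excess)
    (hY : Y ⊂ E(G.deleteVerts D)) :
    (G.edgeInduce Y).excess < (G.edgeInduce E(G.deleteVerts D)).excess := by
  obtain rfl | hne := Y.eq_empty_or_nonempty
  · rwa [excess_edgeInduce_empty]
  · exact h.excess_lt_of_ssubset hE hD hD1 hY hne

/-- Adding an edge at `x` to a set of edges of `G - x` does not create larger excess. -/
theorem excess_le_insert (h : G.IsThreeConnected) (hE : E(G).Finite) (hx : x ∈ V(G))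
    (hex : G.Inc e x) (hY : Y ⊆ insert e E(G.deleteVerts {x})) :
    (G.edgeInduce Y).excess ≤ max 0 (G.edgeInduce E(G.deleteVerts {x})).excess := by
  have hYe : Y \ {e} ⊆ E(G.deleteVerts {x}) := fun f hf ↦ (hY hf.1).resolve_left hf.2
  have hle := h.excess_le hE (Set.singleton_subset_iff.2 hx) (by simp) hYe
  refine le_trans ?_ hle
  by_cases heY : e ∈ Y
  · have hYE : Y ⊆ E(G) :=
      hY.trans (Set.insert_subset hex.edge_mem deleteVerts_le.edgeSet_mono)
    -- `e` is the only edge of `Y` at `x`, so removing it also loses the vertex `x`.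
    have hss : V(G.edgeInduce (Y \ {e})) ⊂ V(G.edgeInduce Y) := by
      refine (vertexSet_edgeInduce_mono Set.sdiff_subset).ssubset_of_mem_notMem
        (a := x) ⟨e, heY, hex⟩ ?_
      rintro ⟨f, hf, hfx⟩
      exact (mem_edgeSet_deleteVerts_singleton.1 (hYe hf)).2 hfx
    have h1 := Set.ncard_lt_ncard hss (G.vertexSet_edgeInduce_finite (hE.subset hYE))
    have h2 := Set.ncard_sdiff_singleton_add_one heY (hE.subset hYE)
    rw [excess_edgeInduce hYE, excess_edgeInduce (Set.sdiff_subset.trans hYE)]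
    omega
  · rw [Set.sdiff_singleton_eq_self heY]

/-- If $x \ne y$, some edge joins `x` to a vertex other than `y` and so avoids `y`. This makes the
correspondence of stars injective. -/
theorem eq_of_incidenceSet_eq (h : G.IsThreeConnected) (hx : x ∈ V(G))
    (hxy : G.incidenceSet x = G.incidenceSet y) : x = y := by
  by_contra hne
  by_cases hy : y ∈ V(G)
  · obtain ⟨e, z, hez, hz⟩ := h.exists_isLink (D := {y}) (Set.singleton_subset_iff.2 hy)
      (by simp) hx hne
    have hey : e ∈ G.incidenceSet y := hxy ▸ hez.inc_left
    obtain h1 | h1 := Inc.eq_or_eq_of_isLink hey hez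
    exacts [hne h1.symm, hz h1.symm]
  · obtain ⟨e, z, hez, -⟩ := h.exists_isLink (D := ∅) (Set.empty_subset _) (by simp) hx (by simp)
    have hey : e ∈ G.incidenceSet y := hxy ▸ hez.inc_left
    exact hy hey.vertex_mem

theorem excess_edgeSet (h : G.IsThreeConnected) :
    (G.edgeInduce E(G)).excess = (E(G).ncard : ℤ) - (V(G).ncard : ℤ) := by
  simpa using h.excess_edgeSet_deleteVerts (Set.empty_subset _) (by simp)

/-! ### Corank, small vertices and tight vertices -/

theorem excess_delete_vertex (h : G.IsThreeConnected) (hV : V(G).Finite) (hE : E(G).Finite)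
    (hx : x ∈ V(G)) : (G.edgeInduce E(G.deleteVerts {x})).excess =
      (E(G).ncard : ℤ) - V(G).ncard - (G.incidenceSet x).ncard + 1 := by
  have h1 := h.excess_edgeSet_deleteVerts (Set.singleton_subset_iff.2 hx) (by simp)
  have h2 := ncard_incidenceSet_add_ncard_edgeSet_deleteVerts hE x
  have h3 := Set.ncard_sdiff_singleton_add_one hx hV
  omega

/-- With `excess_delete_vertex`, this turns smallness of `x` into excess at least $k$ for $G - x$,
and tightness into excess exactly $k-1$. -/
theorem kCorank_eq (h : G.IsThreeConnected) (hE : E(G).Finite) (hk : 1 ≤ k)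
    (hkE : (k : ℤ) ≤ (G.edgeInduce E(G)).excess) :
    ∃ r : ℕ, G.kCorank hE k hk = r ∧ (r : ℤ) = (E(G).ncard : ℤ) - V(G).ncard - k + 1 := by
  have hle : ∀ Y ⊆ E(G), (G.edgeInduce Y).excess ≤ (G.edgeInduce E(G)).excess := by
    intro Y hY
    have := h.excess_le hE (Set.empty_subset _) (by simp) (Y := Y) (by simpa using hY)
    rw [deleteVerts_empty] at this
    omega
  have hr := eRank_kCircularMatroid hE hk hle (by omega)
  have hVE : V(G.edgeInduce E(G)) = V(G) := by
    simpa using h.vertexSet_edgeInduce_edgeSet_deleteVerts (Set.empty_subset _) (by simp)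
  have hsum := (G.kCircularMatroid hE k hk).eRank_add_eRank_dual
  have hgr : (G.kCircularMatroid hE k hk).E = E(G) := by simp [kCircularMatroid]
  rw [hgr, ← hE.cast_ncard_eq, hr, hVE] at hsum
  rw [h.excess_edgeSet] at hkE
  have hne : (G.kCircularMatroid hE k hk)✶.eRank ≠ ⊤ := by
    intro htop
    rw [htop] at hsum
    simp at hsum
  obtain ⟨r, hr'⟩ := ENat.ne_top_iff_exists.1 hne
  rw [← hr'] at hsum
  refine ⟨r, hr'.symm, ?_⟩
  have : V(G).ncard + k - 1 + r = E(G).ncard := by exact_mod_cast hsum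
  omega

/-- A vertex `x` such that `G - x` has excess at least `k` has a star that is a star of `G'`. -/
theorem exists_incidenceSet_eq (h : G.IsThreeConnected) (hV : V(G).Finite) (hE : E(G).Finite)
    (hV' : V(G').Finite) (hE' : E(G').Finite) (hk : 1 ≤ k) (hEE : E(G') = E(G))
    (hC : G'.kCircuits k = G.kCircuits k) (hcard : V(G').ncard = V(G).ncard) (hx : x ∈ V(G))
    (hkx : (k : ℤ) ≤ (G.edgeInduce E(G.deleteVerts {x})).excess) :
    ∃ v ∈ V(G'), G'.incidenceSet v = G.incidenceSet x := by
  set F := E(G.deleteVerts {x}) with hF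
  have hxV : ({x} : Set α) ⊆ V(G) := Set.singleton_subset_iff.2 hx
  have hFE : F ⊆ E(G) := deleteVerts_le.edgeSet_mono
  have hFE' : F ⊆ E(G') := hEE.symm ▸ hFE
  have hex := excess_eq_of_kCircuits_eq hE hE' hk hEE hC hFE hkx
    fun Y hY ↦ h.excess_lt_of_ssubset_of_pos hE hxV (by simp) (hF ▸ by omega) hY
  have hexG := h.excess_edgeSet_deleteVerts hxV (by simp)
  rw [← hF] at hexG
  have hV1 := Set.ncard_sdiff_singleton_add_one hx hV
  have hsub' : V(G'.edgeInduce F) ⊆ V(G') := fun v ⟨e, _, hv⟩ ↦ hv.vertex_mem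
  -- In `G'` the set `F` has the same excess and size as in `G`, so it meets only $|V(G')| - 1$
  -- vertices.
  obtain ⟨v, hv, hvF⟩ : ∃ v ∈ V(G'), v ∉ V(G'.edgeInduce F) := by
    by_contra! hcon
    have := Set.ncard_le_ncard hcon (hV'.subset hsub')
    rw [excess_edgeInduce hFE', hexG] at hex
    omega
  refine ⟨v, hv, ?_⟩
  ext e
  simp only [mem_incidenceSet]
  constructor
  · intro hev
    by_contra hex
    exact hvF ⟨e, mem_edgeSet_deleteVerts_singleton.2 ⟨hEE ▸ hev.edge_mem, hex⟩, hev⟩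
  · intro hex'
    by_contra hev
    have hins : insert e F ⊆ E(G) := Set.insert_subset hex'.edge_mem hFE
    -- In `G` the edge `e` is pendant at `x` over `F`, so the bound survives adding it; in `G'` it
    -- would add an edge while `v` is still missed.
    have hle := excess_le_of_kCircuits_eq (m := (G.edgeInduce F).excess) hE hE' hk hEE hC hins
      (by omega) (fun Y hY ↦ (h.excess_le_insert hE hx hex' hY).trans
        (max_le (by omega) le_rfl)) subset_rfl
    have heF : e ∉ F := fun he ↦ (mem_edgeSet_deleteVerts_singleton.1 he).2 hex'
    have hVins : V(G'.edgeInduce (insert e F)) ⊆ V(G') \ {v} := by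
      rintro u ⟨f, hf, hu⟩
      refine ⟨hu.vertex_mem, ?_⟩
      rintro rfl
      obtain rfl | hf := hf
      exacts [hev hu, hvF ⟨f, hf, hu⟩]
    have h1 := Set.ncard_le_ncard hVins (hV'.subset Set.sdiff_subset)
    have h2 := Set.ncard_sdiff_singleton_add_one hv hV'
    have h3 := Set.ncard_insert_of_notMem heF (hE.subset hFE)
    rw [excess_edgeInduce (hEE.symm ▸ hins), hexG] at hle
    omega

end IsThreeConnected

/-- A loopless graph and a graph with the same vertex stars, indexed injectively, are strongly
isomorphic. -/
theorem stronglyIsomorphic_of_incidenceSet_eq (hG : G.Loopless) (hEE : E(G) = E(G'))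
    (ν : V(G) ≃ V(G')) (hν : ∀ x, G'.incidenceSet (ν x) = G.incidenceSet x) :
    G.StronglyIsomorphic G' := by
  have hinc : ∀ e x, G'.Inc e (ν x) ↔ G.Inc e x := fun e x ↦ Set.ext_iff.1 (hν x) e
  have hlink : ∀ (e : β) (x y : V(G)), G.IsLink e x y → G'.IsLink e (ν x) (ν y) := by
    intro e x y hxy
    -- Looplessness makes the two images distinct, so incidence with both determines the ends of `e`
    -- in `G'`.
    have hne : (ν x : α') ≠ ν y := fun h ↦
      hxy.ne (congrArg Subtype.val (ν.injective (Subtype.ext h)))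
    obtain ⟨z, hz⟩ := (hinc e x).2 hxy.inc_left
    obtain h1 | h1 := ((hinc e y).2 hxy.inc_right).eq_or_eq_of_isLink hz
    · exact absurd h1.symm hne
    · rwa [h1]
  refine ⟨hEE, ν, fun e x y ↦ ⟨hlink e x y, fun hxy ↦ ?_⟩⟩
  obtain ⟨a, b, hab⟩ := G.exists_isLink_of_mem_edgeSet (hEE ▸ hxy.edge_mem)
  have hab' := hlink e ⟨a, hab.left_mem⟩ ⟨b, hab.right_mem⟩ hab
  obtain ⟨h1, h2⟩ | ⟨h1, h2⟩ := hxy.eq_and_eq_or_eq_and_eq hab'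
  · have h3 := ν.injective (Subtype.ext h1)
    have h4 := ν.injective (Subtype.ext h2)
    rwa [h3, h4]
  · have h3 := ν.injective (Subtype.ext h1)
    have h4 := ν.injective (Subtype.ext h2)
    rw [h3, h4]
    exact hab.symm

end ThreeConnected

/-! ### The star of the tight vertex -/

section TightVertex

variable {α α' β : Type*} {G : Graph α β} {G' : Graph α' β} {x t : α} {k : ℕ}

/-- If the stars of all vertices but `t` are stars of `G'`, and `G - t` has excess `k - 1`, then the
star of `t` is a star of `G'`. -/
theorem IsThreeConnected.exists_incidenceSet_eq_of_forall_ne (h : G.IsThreeConnected)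
    (hV : V(G).Finite) (hE : E(G).Finite) (hV' : V(G').Finite) (hE' : E(G').Finite) (hk : 1 ≤ k)
    (hEE : E(G') = E(G)) (hC : G'.kCircuits k = G.kCircuits k)
    (hcard : V(G').ncard = V(G).ncard) (ht : t ∈ V(G))
    (hkt : (G.edgeInduce E(G.deleteVerts {t})).excess = k - 1)
    (hstar : ∀ x ∈ V(G), x ≠ t → ∃ v ∈ V(G'), G'.incidenceSet v = G.incidenceSet x) :
    ∃ v ∈ V(G'), G'.incidenceSet v = G.incidenceSet t := by
  have := h.1
  set F := E(G.deleteVerts {t}) with hF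
  have htV : ({t} : Set α) ⊆ V(G) := Set.singleton_subset_iff.2 ht
  have hFE : F ⊆ E(G) := deleteVerts_le.edgeSet_mono
  have hexG := h.excess_edgeSet_deleteVerts htV (by simp)
  rw [← hF] at hexG
  have hV1 := Set.ncard_sdiff_singleton_add_one ht hV
  obtain ⟨w, hw, hwt⟩ := h.exists_notMem (S := {t}) (by simp)
  have : Nonempty α' := ⟨(hstar w hw hwt).choose⟩
  choose! φ _ hφ using hstar
  -- Pigeonhole: `φ` takes at most $|V(G)| - 1$ values on the vertices other than `t`.
  obtain ⟨t', ht', hφt⟩ : ∃ t' ∈ V(G'), t' ∉ φ '' (V(G) \ {t}) := by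
    by_contra! hcon
    have h1 := Set.ncard_le_ncard hcon ((hV.subset Set.sdiff_subset).image φ)
    have h2 := Set.ncard_image_le (f := φ) (hV.subset (Set.sdiff_subset : V(G) \ {t} ⊆ V(G)))
    omega
  have hφinc : ∀ e x, x ∈ V(G) → x ≠ t → G.Inc e x → G'.Inc e (φ x) := by
    intro e x hx hxt hex
    have : e ∈ G'.incidenceSet (φ x) := by rwa [hφ x hx hxt]
    exact this
  -- The ends `a`, `b` of an edge of $G - t$ have different stars, so `φ a` and `φ b` are distinct
  -- and are all the ends of the edge in `G'`.
  have hFt : ∀ e ∈ F, ¬ G'.Inc e t' := by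
    intro e he het
    rw [hF, edgeSet_deleteVerts] at he
    obtain ⟨a, b, hab, ha, hb⟩ := he
    have ha' := hφinc e a hab.left_mem ha hab.inc_left
    have hb' := hφinc e b hab.right_mem hb hab.inc_right
    have hta : t' ≠ φ a := fun h ↦ hφt ⟨a, ⟨hab.left_mem, ha⟩, h.symm⟩
    have htb : t' ≠ φ b := fun h ↦ hφt ⟨b, ⟨hab.right_mem, hb⟩, h.symm⟩
    have hne : φ a ≠ φ b := by
      intro heq
      refine hab.ne (h.eq_of_incidenceSet_eq hab.left_mem ?_)
      rw [← hφ a hab.left_mem ha, ← hφ b hab.right_mem hb, heq]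
    obtain h1 | h1 | h1 := het.eq_or_eq_or_eq ha' hb'
    exacts [hta h1, htb h1, hne h1]
  refine ⟨t', ht', ?_⟩
  ext e
  simp only [mem_incidenceSet]
  constructor
  · intro het
    by_contra hnot
    exact hFt e (mem_edgeSet_deleteVerts_singleton.2 ⟨hEE ▸ het.edge_mem, hnot⟩) het
  · intro het
    by_contra hnot
    have hins : insert e F ⊆ E(G) := Set.insert_subset het.edge_mem hFE
    -- The bound $k-1$ is the least that transfers. In `G'`, $F + e$ would miss `t'` and so have
    -- excess at least $k$.
    have hle := excess_le_of_kCircuits_eq (m := (k : ℤ) - 1) hE hE' hk hEE hC hins le_rfl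
      (fun Y hY ↦ (h.excess_le_insert hE ht het hY).trans (max_le (by omega) hkt.le)) subset_rfl
    have heF : e ∉ F := fun he ↦ (mem_edgeSet_deleteVerts_singleton.1 he).2 het
    have hVins : V(G'.edgeInduce (insert e F)) ⊆ V(G') \ {t'} := by
      rintro u ⟨f, hf, hu⟩
      refine ⟨hu.vertex_mem, ?_⟩
      rintro rfl
      obtain rfl | hf := hf
      exacts [hnot hu, hFt f hf hu]
    have h1 := Set.ncard_le_ncard hVins (hV'.subset Set.sdiff_subset)
    have h2 := Set.ncard_sdiff_singleton_add_one ht' hV'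
    have h3 := Set.ncard_insert_of_notMem heF (hE.subset hFE)
    rw [excess_edgeInduce (hEE.symm ▸ hins)] at hle
    omega

end TightVertex

end Graph

/-! ### Assembling the bijection of stars -/

theorem mainTheorem4 {α α' β : Type*} (G : Graph α β) (G' : Graph α' β)
    (hV : G.vertexSet.Finite) (hE : G.edgeSet.Finite)
    (hV' : G'.vertexSet.Finite) (hE' : G'.edgeSet.Finite)
    (hiso' : ∀ v ∈ G'.vertexSet, ∃ e, G'.Inc e v)
    (k : ℕ) (hk : 1 ≤ k) (t : α) (ht : t ∈ G.vertexSet)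
    (hconn : G.IsThreeConnected)
    (hcirc : (G.kCircuits k).Nonempty)
    (htight : G.IsKTight hE k hk t)
    (hsmall : ∀ x ∈ G.vertexSet, x ≠ t → G.IsKSmall hE k hk x)
    (hM : G'.kCircularMatroid hE' k hk = G.kCircularMatroid hE k hk) :
    G.starFamily = G'.starFamily ∧ G.StronglyIsomorphic G' := by
  have hEE : G'.edgeSet = G.edgeSet := by
    simpa [Graph.kCircularMatroid] using congrArg Matroid.E hM
  have hC : G'.kCircuits k = G.kCircuits k := by
    ext C
    rw [← G'.kCircularMatroid_isCircuit_iff hE' k hk, hM, G.kCircularMatroid_isCircuit_iff]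
  have hkE : (k : ℤ) ≤ (G.edgeInduce G.edgeSet).excess := by
    obtain ⟨C, hCE, hCk, -⟩ := hcirc
    have := hconn.excess_le hE (Set.empty_subset _) (by simp) (Y := C) (by simpa using hCE)
    rw [Graph.deleteVerts_empty] at this
    omega
  -- $E(G)$ has the same excess in both graphs, and the absence of isolated vertices in `G'` makes
  -- that excess count all of its vertices.
  have hcard : G'.vertexSet.ncard = G.vertexSet.ncard := by
    have h1 := Graph.excess_eq_of_kCircuits_eq hE hE' hk hEE hC subset_rfl hkE fun Y hY ↦ by
      have := hconn.excess_lt_of_ssubset_of_pos hE (Set.empty_subset _) (by simp) (Y := Y)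
      rw [Graph.deleteVerts_empty] at this
      exact this (by omega) hY
    have h2 : (G'.edgeInduce G.edgeSet).vertexSet = G'.vertexSet := by
      ext v
      refine ⟨fun ⟨e, _, hv⟩ ↦ hv.vertex_mem, fun hv ↦ ?_⟩
      obtain ⟨e, he⟩ := hiso' v hv
      exact ⟨e, hEE ▸ he.edge_mem, he⟩
    rw [Graph.excess_edgeInduce hEE.symm.subset, h2, hconn.excess_edgeSet] at h1
    omega
  obtain ⟨r, hr, hrG⟩ := hconn.kCorank_eq hE hk hkE
  have hSfin : ∀ x, (G.incidenceSet x).Finite := fun x ↦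
    hE.subset (G.incidenceSet_subset_edgeSet x)
  have hstar : ∀ x ∈ G.vertexSet, x ≠ t →
      ∃ v ∈ G'.vertexSet, G'.incidenceSet v = G.incidenceSet x := by
    intro x hx hxt
    refine hconn.exists_incidenceSet_eq hV hE hV' hE' hk hEE hC hcard hx ?_
    have hs := hsmall x hx hxt
    rw [Graph.IsKSmall, Graph.starSize, hr, ← (hSfin x).cast_ncard_eq] at hs
    have hs' : (G.incidenceSet x).ncard < r + 1 := by exact_mod_cast hs
    rw [hconn.excess_delete_vertex hV hE hx]
    omega
  have hstar_t : ∃ v ∈ G'.vertexSet, G'.incidenceSet v = G.incidenceSet t := by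
    refine hconn.exists_incidenceSet_eq_of_forall_ne hV hE hV' hE' hk hEE hC hcard ht ?_ hstar
    rw [Graph.IsKTight, Graph.starSize, hr, ← (hSfin t).cast_ncard_eq] at htight
    have ht' : (G.incidenceSet t).ncard = r + 1 := by exact_mod_cast htight
    rw [hconn.excess_delete_vertex hV hE ht]
    omega
  have hall : ∀ x : G.vertexSet, ∃ v : G'.vertexSet, G'.incidenceSet v = G.incidenceSet x := by
    rintro ⟨x, hx⟩
    obtain ⟨v, hv, h⟩ : ∃ v ∈ G'.vertexSet, G'.incidenceSet v = G.incidenceSet x := by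
      by_cases hxt : x = t
      exacts [hxt ▸ hstar_t, hstar x hx hxt]
    exact ⟨⟨v, hv⟩, h⟩
  choose ν hν using hall
  have hinj : Function.Injective ν := fun x y hxy ↦
    Subtype.ext (hconn.eq_of_incidenceSet_eq x.2 (by rw [← hν, ← hν, hxy]))
  have := hV'.to_subtype
  -- An injection between finite sets of equal size, so every star of `G'` is reached.
  have hbij : Function.Bijective ν :=
    (Nat.bijective_iff_injective_and_card ν).2 ⟨hinj, hcard.symm⟩
  refine ⟨?_, Graph.stronglyIsomorphic_of_incidenceSet_eq hconn.1 hEE.symm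
    (Equiv.ofBijective ν hbij) hν⟩
  ext S
  constructor
  · rintro ⟨x, hx, rfl⟩
    exact ⟨ν ⟨x, hx⟩, (ν ⟨x, hx⟩).2, (hν ⟨x, hx⟩).symm⟩
  · rintro ⟨v, hv, rfl⟩
    obtain ⟨x, hx⟩ := hbij.2 ⟨v, hv⟩
    exact ⟨x, x.2, by rw [← hν, hx]⟩
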